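/- **First decomposition of global loops.** Let $\mathcal K=(V,E,F)$ be a finite triangulation (a regular CW complex whose cells are simplices) of a connected compact surface, with or without boundary, orientable or not, with arbitrarily oriented cells and incidence numbers $\iota(f,e)\in\{0,\pm1\}$. Let $\bar{\mathcal K}$ be the CW complex obtained from $\mathcal K$ by collapsing each connected component of $\partial\mathcal K$ to one $0$-cell: its $2$-cells are the faces of $\mathcal K$, its $1$-cells the edges of $\mathcal K$ not in $\partial\mathcal K$, and its $0$-cells the nodes of $\mathcal K$ with all nodes of one boundary component identified. A $1$-cochain of $\mathcal K$ that vanishes on all boundary edges is regarded as a $1$-cochain of $\bar{\mathcal K}$. *Trees.* Let $T$ be the edge set of a spanning tree of the $1$-skeleton of $\mathcal K$ that restricts to a spanning tree of each component of $\partial\mathcal K$. Let $S$ be a set of non-boundary edges not in $T$ whose dual edges (joining the two faces at the edge) form a spanning tree on the set of faces. Let $E_M$ be the set of the non-boundary edges that are in neither $T$ nor $S$. *Cochain of a path.* Let $f_1,\dots,f_l$ be distinct faces and $e_1,\dots,e_{l-1}$ distinct edges such that $e_i$ is shared by $f_i$ and $f_{i+1}$. Let $e$ be a side of $f_1$ and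 $e'$ a side of $f_l$, neither among the $e_i$. Put $e_0=e$, $e_l=e'$, $a_0=1$ and $a_i=-\frac{\iota(f_i,e_i)}{\iota(f_i,e_{i-1})}\,a_{i-1}$ for $1\le i\le l$. If $e'=e$ and $a_l\ne 1$, the cochain of the path and the pair $(e,e')$ is $0$; otherwise it is the $1$-cochain with the value $a_i$ on $e_i$ for $0\le i\le l$ and $0$ on all other edges. *Handle cochains.* For $e\in E_M$ let $f_e^{(1)},f_e^{(2)}$ be the two faces at $e$, in any order, and let $g_e$ be the cochain of the unique path in the dual tree $S$ from $f_e^{(1)}$ to $f_e^{(2)}$ and the pair $(e,e)$. Let $E_M^{\mathrm{II}}=\{e\in E_M: g_e=0\}$. 1. If $E_M^{\mathrm{II}}=\emptyset$, put $g_e^{\mathrm{ha}}=g_e$ for $e\in E_M$ and $\mathcal G^{\mathrm{ha}}=(g_e^{\mathrm{ha}})_{e\in E_M}$. 2. If $E_M^{\mathrm{II}}\neq\emptyset$, choose any $e^*\in E_M^{\mathrm{II}}$. For $e\in E_M\setminus E_M^{\mathrm{II}}$ put $g_e^{\mathrm{ha}}=g_e$. For $e\in E_M^{\mathrm{II}}\setminus\{e^*\}$,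 label the two faces at $e^*$ as $f_{e^*}^{(1)},f_{e^*}^{(2)}$ in any order and, for $k=1,2$, let $g_e^{(k)}$ be the cochain of the unique path in $S$ from $f_e^{(k)}$ to $f_{e^*}^{(k)}$ and the pair $(e,e^*)$; let $g_e^{\mathrm{ha}}$ be equal to $g_e^{(1)}$ on $e$ and $e^*$, and to $g_e^{(1)}+g_e^{(2)}$ on all other edges. Put $\mathcal G^{\mathrm{ha}}=(g_e^{\mathrm{ha}})_{e\in E_M\setminus\{e^*\}}$. Then, for all choices made, every member of $\mathcal G^{\mathrm{ha}}$ vanishes on the boundary edges and is a $1$-cocycle of $\bar{\mathcal K}$, and the cohomology classes of the members of the family $\mathcal G^{\mathrm{ha}}$ form a basis of $H^1(\bar{\mathcal K};\mathbb R)$. In particular $H^1(\bar{\mathcal K};\mathbb R)\cong\operatorname{span}\{[g]: g\in\mathcal G^{\mathrm{ha}}\}$, of dimension $|E_M|$ in case 1 and $|E_M|-1$ in case 2. -/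

import Mathlib

noncomputable section

/-- Combinatorial data of a finite regular two-dimensional CW complex all of whose cells are
simplices (`V`, `E`, `F` are the sets of nodes, edges and faces), together with an orientation of
every cell. Regularity means that an edge has two distinct end nodes and a face three distinct
corners; different cells may have the same corners. The edge `e` is oriented from `src e` to
`tgt e`; the face `f` has the corners `vert f 0, vert f 1, vert f 2`, is oriented in this cyclic
order, and its side `edge f i` joins `vert f i` to `vert f (i + 1)` (indices modulo 3). -/
structure TriComplex (V E F : Type*) where
  src : E → V
  tgt : E → V
  src_ne_tgt : ∀ e, src e ≠ tgt e
  vert : F → Fin 3 → V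
  vert_injective : ∀ f, Function.Injective (vert f)
  edge : F → Fin 3 → E
  edge_ends : ∀ f i, s(src (edge f i), tgt (edge f i)) = s(vert f i, vert f (i + 1))

namespace TriComplex

variable {V E F : Type*} (K : TriComplex V E F)

/-! ### Surfaces -/

/-- The edge `e` is a side of the face `f`. -/
def IsSide (e : E) (f : F) : Prop := ∃ i, K.edge f i = e

/-- The graph on all nodes formed by the edges in `S` (parallel edges are merged). -/
def graphOf (S : Set E) : SimpleGraph V :=
  SimpleGraph.fromEdgeSet ((fun e => s(K.src e, K.tgt e)) '' S)

/-- The link of the node `v`: its points are the edges at `v`, and two of them are adjacent when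
they are sides of a common face. -/
def link (v : V) : SimpleGraph {e : E // K.src e = v ∨ K.tgt e = v} where
  Adj a b := a ≠ b ∧ ∃ f, K.IsSide a.1 f ∧ K.IsSide b.1 f
  symm := ⟨fun _ _ h => ⟨h.1.symm, h.2.imp fun _ hf => ⟨hf.2, hf.1⟩⟩⟩
  loopless := ⟨fun _ h => h.1 rfl⟩

/-- `K` triangulates a connected surface (2-manifold), possibly with boundary: every edge is a
side of one or two faces, every link is connected (hence an arc or a circle), and the
1-skeleton is connected. -/
structure IsSurface : Prop where
  edge_faces : ∀ e, {f | K.IsSide e f}.ncard = 1 ∨ {f | K.IsSide e f}.ncard = 2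
  link_connected : ∀ v, (K.link v).Connected
  connected : (K.graphOf Set.univ).Connected

/-- The boundary edges: those that are a side of exactly one face. -/
def boundaryEdges : Set E := {e | {f | K.IsSide e f}.ncard = 1}

/-- The graph of the boundary, on all nodes; nodes that do not lie on the boundary are
isolated. -/
def boundaryGraph : SimpleGraph V := K.graphOf K.boundaryEdges

open scoped Classical in
/-- Incidence number of a face and an edge: `1` if the edge is a side of the face and is
traversed along its orientation by the oriented boundary of the face, `-1` if it is traversed
against its orientation, and `0` if it is not a side of the face. -/
def inc (f : F) (e : E) : ℤ :=
  ∑ i : Fin 3, if K.edge f i = e then (if K.src e = K.vert f i then 1 else -1) else 0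

/-! ### The closed complex obtained by collapsing the boundary components

Its 2-cells are the faces of `K`, its 1-cells the edges of `K` that are not on the boundary, and
its 0-cells the nodes of `K`, where all nodes of one boundary component are identified. -/

/-- The 0-cells of the closed complex. -/
def BarNode : Type _ := K.boundaryGraph.ConnectedComponent

/-- The 1-cells of the closed complex. -/
def BarEdge : Type _ := {e : E // e ∉ K.boundaryEdges}

instance [Finite V] : Finite K.BarNode :=
  Finite.of_surjective K.boundaryGraph.connectedComponentMk Quot.mk_surjective

instance [Finite E] : Finite K.BarEdge :=
  inferInstanceAs (Finite {e : E // e ∉ K.boundaryEdges})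

instance [Finite V] : Fintype K.BarNode := Fintype.ofFinite _

instance [Finite E] : Fintype K.BarEdge := Fintype.ofFinite _

/-- The 0-cell of the closed complex that contains a given node of `K`. -/
def toBarNode (v : V) : K.BarNode := K.boundaryGraph.connectedComponentMk v

open scoped Classical in
/-- Incidence number of a 1-cell and a 0-cell of the closed complex; it is `0` when the 1-cell is
a loop. -/
def barIncEdge (e : K.BarEdge) (n : K.BarNode) : ℤ :=
  (if K.toBarNode (K.tgt e.1) = n then 1 else 0) - (if K.toBarNode (K.src e.1) = n then 1 else 0)

/-- Incidence number of a 2-cell and a 1-cell of the closed complex. -/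
def barIncFace (f : F) (e : K.BarEdge) : ℤ := K.inc f e.1

/-- The coboundary map from 0-cochains to 1-cochains of the closed complex. -/
def barD0 [Finite V] : (K.BarNode → ℝ) →ₗ[ℝ] (K.BarEdge → ℝ) where
  toFun φ e := ∑ n, (K.barIncEdge e n : ℝ) * φ n
  map_add' φ ψ := by
    funext e; simp [mul_add, Finset.sum_add_distrib]
  map_smul' a φ := by
    funext e; simp [Finset.mul_sum, mul_left_comm]

/-- The coboundary map from 1-cochains to 2-cochains of the closed complex. -/
def barD1 [Finite E] : (K.BarEdge → ℝ) →ₗ[ℝ] (F → ℝ) where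
  toFun c f := ∑ e, (K.barIncFace f e : ℝ) * c e
  map_add' φ ψ := by
    funext e; simp [mul_add, Finset.sum_add_distrib]
  map_smul' a φ := by
    funext e; simp [Finset.mul_sum, mul_left_comm]

/-- The 1-cocycles of the closed complex. -/
abbrev barZ1 [Finite E] : Submodule ℝ (K.BarEdge → ℝ) := LinearMap.ker K.barD1

/-- The 1-coboundaries of the closed complex. -/
abbrev barB1 [Finite V] : Submodule ℝ (K.BarEdge → ℝ) := LinearMap.range K.barD0

/-- The coboundary of a coboundary is zero. -/
theorem barD1_barD0 [Finite V] [Finite E] (φ : K.BarNode → ℝ) : K.barD1 (K.barD0 φ) = 0 := by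
  classical
  let ψ : V → ℝ := fun v => φ (K.toBarNode v)
  have h0 : ∀ e, K.barD0 φ e = ψ (K.tgt e.1) - ψ (K.src e.1) := by
    intro e
    simp [barD0, barIncEdge, ψ, sub_mul, Finset.sum_sub_distrib]
  have hb : ∀ e ∈ K.boundaryEdges, ψ (K.tgt e) = ψ (K.src e) := by
    intro e he
    have : K.boundaryGraph.Adj (K.tgt e) (K.src e) := by
      simp only [boundaryGraph, graphOf, SimpleGraph.fromEdgeSet_adj]
      exact ⟨⟨e, he, Sym2.eq_swap⟩, (K.src_ne_tgt e).symm⟩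
    have h2 : K.toBarNode (K.tgt e) = K.toBarNode (K.src e) :=
      SimpleGraph.ConnectedComponent.sound this.reachable
    simp only [ψ, h2]
  funext f
  have h1 : K.barD1 (K.barD0 φ) f =
      ∑ e : K.BarEdge, (K.inc f e.1 : ℝ) * (ψ (K.tgt e.1) - ψ (K.src e.1)) := by
    simp [barD1, barIncFace, h0]
  rw [h1]
  have : Fintype E := Fintype.ofFinite E
  have h2 : ∑ e : K.BarEdge, (K.inc f e.1 : ℝ) * (ψ (K.tgt e.1) - ψ (K.src e.1)) =
      ∑ e : E, (K.inc f e : ℝ) * (ψ (K.tgt e) - ψ (K.src e)) := by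
    refine Finset.sum_of_injOn (fun e : K.BarEdge => e.1) ?_ ?_ ?_ ?_
    · intro a _ b _ hab; exact Subtype.ext hab
    · intro a _; simp
    · intro e _ he
      have : e ∈ K.boundaryEdges := by
        by_contra hne
        exact he ⟨⟨e, hne⟩, by rw [Finset.coe_univ]; trivial, rfl⟩
      rw [hb e this]; simp
    · intro a _; rfl
  rw [h2]
  have h3 : ∀ i, (∑ e : E, (if K.edge f i = e then
      (if K.src e = K.vert f i then (1 : ℝ) else -1) else 0) * (ψ (K.tgt e) - ψ (K.src e))) =
      ψ (K.vert f (i + 1)) - ψ (K.vert f i) := by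
    intro i
    simp only [ite_mul, zero_mul, Finset.sum_ite_eq, Finset.mem_univ, if_true]
    have h := K.edge_ends f i
    have hne := K.src_ne_tgt (K.edge f i)
    rw [Sym2.eq_iff] at h
    rcases h with ⟨ha, hb⟩ | ⟨ha, hb⟩
    · simp [ha, hb]
    · have : K.src (K.edge f i) ≠ K.vert f i := by rw [← hb]; exact hne
      rw [if_neg this, ha, hb]; ring
  have h4 : ∑ e : E, (K.inc f e : ℝ) * (ψ (K.tgt e) - ψ (K.src e)) =
      ∑ i : Fin 3, (ψ (K.vert f (i + 1)) - ψ (K.vert f i)) := by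
    simp_rw [← h3]
    rw [Finset.sum_comm]
    refine Finset.sum_congr rfl fun e _ => ?_
    simp only [inc]
    push_cast
    rw [Finset.sum_mul]
  rw [h4, Fin.sum_univ_three]
  simp only [Fin.isValue, zero_add, Pi.zero_apply]
  have e1 : (1 : Fin 3) + 1 = 2 := rfl
  have e2 : (2 : Fin 3) + 1 = 0 := rfl
  rw [e1, e2]; ring

theorem barB1_le_barZ1 [Finite V] [Finite E] : K.barB1 ≤ K.barZ1 := by
  rintro _ ⟨φ, rfl⟩
  exact K.barD1_barD0 φ

/-- The first real cohomology of the closed complex, cocycles modulo coboundaries. -/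
abbrev BarH1 [Finite V] [Finite E] : Type _ := K.barZ1 ⧸ K.barB1.submoduleOf K.barZ1

/-- The family `g` of 1-cochains of `K` represents a basis of the first cohomology of the closed
complex: every `g i` vanishes on the boundary edges, so that it is a 1-cochain of the closed
complex, it is a cocycle there, and the cohomology classes of the `g i` form a basis, indexed
by `i`. -/
def RepresentsBasis [Finite V] [Finite E] {ι : Type*} (g : ι → E → ℝ) : Prop :=
  (∀ i, ∀ e ∈ K.boundaryEdges, g i e = 0) ∧
  ∃ hz : ∀ i, (fun e : K.BarEdge => g i e.1) ∈ K.barZ1,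
    ∃ b : Module.Basis ι ℝ K.BarH1,
      ∀ i, b i = (K.barB1.submoduleOf K.barZ1).mkQ ⟨fun e => g i e.1, hz i⟩

/-! ### The two trees -/

/-- The dual edge of `e` joins the faces `f` and `f'`. -/
def DualJoins (e : E) (f f' : F) : Prop := f ≠ f' ∧ K.IsSide e f ∧ K.IsSide e f'

/-- The graph on all faces formed by the dual edges of the edges in `S` (parallel dual edges are
merged). -/
def dualGraphOf (S : Set E) : SimpleGraph F where
  Adj f f' := ∃ e ∈ S, K.DualJoins e f f'
  symm := ⟨fun _ _ ⟨e, he, h⟩ => ⟨e, he, h.1.symm, h.2.2, h.2.1⟩⟩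
  loopless := ⟨fun _ ⟨_, _, h⟩ => h.1 rfl⟩

/-- The choice of the two trees. `T` is the edge set of a spanning tree of `K` that restricts to
a spanning tree on every boundary component (it is obtained by extending such trees). `S`
consists of non-boundary edges outside `T`, and the dual edges of `S` form a spanning tree on the
faces. -/
structure TreePair where
  T : Set E
  T_isTree : (K.graphOf T).IsTree
  T_noParallel : Set.InjOn (fun e => s(K.src e, K.tgt e)) T
  T_boundary : ∀ v w, K.boundaryGraph.Reachable v w →
    (K.graphOf (T ∩ K.boundaryEdges)).Reachable v w
  S : Set E
  S_subset : ∀ e ∈ S, e ∉ T ∧ e ∉ K.boundaryEdges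
  S_isTree : (K.dualGraphOf S).IsTree
  S_noParallel : ∀ e ∈ S, ∀ e' ∈ S, ∀ f f',
    K.DualJoins e f f' → K.DualJoins e' f f' → e = e'

/-! ### Paths in the dual graph and the cochains they carry -/

/-- A walk in the dual graph from face to face, with dual edges from `S`. -/
inductive DualWalk (S : Set E) : F → F → Type _
  | nil (f : F) : DualWalk S f f
  | cons {f f' f'' : F} (e : E) (he : e ∈ S) (h : K.DualJoins e f f')
      (p : DualWalk S f' f'') : DualWalk S f f''

namespace DualWalk

variable {K} {S : Set E}

/-- The faces visited by the walk. -/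
def faces : {f f' : F} → K.DualWalk S f f' → List F
  | _, _, nil f => [f]
  | f, _, cons _ _ _ p => f :: p.faces

/-- The edges crossed by the walk. -/
def edges : {f f' : F} → K.DualWalk S f f' → List E
  | _, _, nil _ => []
  | _, _, cons e _ _ p => e :: p.edges

/-- A path is a walk with distinct faces and distinct dual edges. -/
def IsPath {f f' : F} (p : K.DualWalk S f f') : Prop := p.faces.Nodup ∧ p.edges.Nodup

/-- The value that a cochain with value `c a` on the side `a` of `f` needs on the side `e` of `f`
for the two contributions to the coboundary on `f` to cancel. -/
def nextValue (K : TriComplex V E F) (f : F) (a e : E) (c : E → ℝ) : ℝ :=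
  -((K.inc f e : ℝ) / (K.inc f a : ℝ)) * c a

open scoped Classical in
/-- Starting from the cochain `c` and the edge `a`, run through the edges crossed by the walk and
assign to each of them the value determined by its predecessor. The result is the final cochain,
with the last edge reached. -/
def sweep : {f f' : F} → K.DualWalk S f f' → E → (E → ℝ) → (E → ℝ) × E
  | _, _, nil _, a, c => (c, a)
  | f, _, cons e _ _ p, a, c => p.sweep e (Function.update c e (nextValue K f a e c))

open scoped Classical in
/-- The cochain carried by a path `p` and a pair `(e, e')` of edges, `e` a side of the first face
and `e'` of the last one. It has the value `1` on `e`, the values on the edges crossed are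
determined one after the other, and so is finally the value on `e'`. When `e' = e` and the last
value contradicts the initial value `1`, the result is the zero cochain. -/
def cochain {f f' : F} (p : K.DualWalk S f f') (e e' : E) : E → ℝ :=
  let r := p.sweep e (Pi.single e 1)
  let z := nextValue K f' r.2 e' r.1
  if e' = e ∧ z ≠ 1 then 0 else Function.update r.1 e' z

end DualWalk

/-! ### The construction of the handle cochains -/

namespace TreePair

variable {K} (P : K.TreePair)

/-- The edges whose duals are in the completed dual tree: one adds to `S` the edges of the boundary
components that are not in `T`, each with a pendant dual node of its own. -/
def dualTreeEdges : Set E := P.S ∪ {e | e ∈ K.boundaryEdges ∧ e ∉ P.T}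

/-- The edges that are not in the tree and whose duals are not in the dual tree. -/
def EM : Set E := {e | e ∉ P.T ∧ e ∉ P.dualTreeEdges}

/-- The choices of the first loop: for every `e` in `EM` a labelling `face₁ e, face₂ e` of the two
faces at `e`, and the path in the dual tree from the first to the second. -/
structure FirstLoop where
  face₁ : P.EM → F
  face₂ : P.EM → F
  joins : ∀ e : P.EM, K.DualJoins e.1 (face₁ e) (face₂ e)
  path : ∀ e : P.EM, K.DualWalk P.S (face₁ e) (face₂ e)
  isPath : ∀ e, (path e).IsPath

variable {P}

/-- The cochain computed for `e` by the first loop. -/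
def FirstLoop.cochain (A : P.FirstLoop) (e : P.EM) : E → ℝ := (A.path e).cochain e.1 e.1

/-- The torsion edges: those for which the first loop returns the zero cochain. -/
def FirstLoop.EMII (A : P.FirstLoop) : Set P.EM := {e | A.cochain e = 0}

/-- The choices of the second loop, when `e₀` is the selected torsion edge: in the iteration for
`e`, a labelling `star₁ e, star₂ e` of the two faces at `e₀`, and the paths in the dual tree from
the first face at `e` to the first face at `e₀` and from the second to the second. Only those for
torsion edges `e ≠ e₀` are used. -/
structure FirstLoop.SecondLoop (A : P.FirstLoop) (e₀ : P.EM) where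
  star₁ : P.EM → F
  star₂ : P.EM → F
  joins : ∀ e, K.DualJoins e₀.1 (star₁ e) (star₂ e)
  path₁ : ∀ e, K.DualWalk P.S (A.face₁ e) (star₁ e)
  path₂ : ∀ e, K.DualWalk P.S (A.face₂ e) (star₂ e)
  isPath₁ : ∀ e, (path₁ e).IsPath
  isPath₂ : ∀ e, (path₂ e).IsPath

open scoped Classical in
/-- The cochain finally returned for `e ≠ e₀`: on torsion edges the one computed by the second
loop, otherwise the one computed by the first. -/
def FirstLoop.SecondLoop.cochain {A : P.FirstLoop} {e₀ : P.EM} (B : A.SecondLoop e₀) (e : P.EM) : E → ℝ :=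
  if e ∈ A.EMII then
    fun a =>
      if a = e.1 ∨ a = e₀.1 then (B.path₁ e).cochain e.1 e₀.1 a
      else (B.path₁ e).cochain e.1 e₀.1 a + (B.path₂ e).cochain e.1 e₀.1 a
  else A.cochain e

end TreePair

end TriComplex

end

/-! Every class in the first cohomology of the collapsed complex has exactly one representative
vanishing on `T`. Existence: a cochain can be integrated along `T` to a potential, which is constant
on boundary components because `T` spans each of them (`exists_barD0_eq`). Uniqueness: a coboundary
vanishing on `T` has a constant potential (`barD0_eq_zero`). So it suffices to find a basis of the
cocycles vanishing on `T`; extended by zero, they live on `S` and `EM`.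

On the dual tree the transpose of the coboundary is onto, so a cocycle supported on `S` is zero
(`eq_zero_of_coboundary_eq_zero`) and a cocycle of the above kind is determined by its values on
`EM`. The only possible constraint on these values comes from face signs `σ` that orient the dual
tree coherently (`exists_signs`): pairing a cocycle with `σ` removes all edges of `S`. For a torsion
edge the two terms of its coefficient agree and add up to ±2 (`cochain_closed`), so once all values
on `EM` except that of `e₀` vanish, the last one vanishes too.

The path cochains supply cocycles dual to the remaining edges. A sweep carries the coboundary from
face to face (`sweep_spec`). A closed path gives a cocycle unless signs disagree; for two torsion
edges, two paths are glued, and their end values match by the `σ`-pairing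
(`SecondLoop.cochain_spec`). Duality gives independence, and determination by the values on `EM`
gives spanning (`representsBasis_of_dual`). -/

namespace SimpleGraph

/-! ### Potentials on trees. -/

/-- Transition rules along the edges of a tree, inverse to each other in the two directions, admit
a potential with a prescribed value at one vertex. -/
theorem IsTree.exists_potential {V M : Type*} {G : SimpleGraph V} (hG : G.IsTree)
    (t : V → V → M → M) (ht : ∀ v w, G.Adj v w → ∀ m, t w v (t v w m) = m) (r : V) (m₀ : M) :
    ∃ p : V → M, p r = m₀ ∧ ∀ v w, G.Adj v w → p w = t v w (p v) := by
  classical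
  let transport : ∀ {u v : V}, G.Walk u v → M → M :=
    fun q m => q.darts.foldl (fun m d => t d.fst d.snd m) m
  choose q hq _ using hG.existsUnique_path r
  -- Of two adjacent vertices, one lies on the path from the root to the other, and that path ends
  -- with their edge.
  have key : ∀ v w (h : G.Adj v w), v ∈ (q w).support →
      transport (q w) m₀ = t v w (transport (q v) m₀) := by
    intro v w h hv
    rw [hG.isAcyclic.path_concat (hq v) (hq w) h hv]
    simp [transport, Walk.darts_concat]
  refine ⟨fun v => transport (q v) m₀, ?_, fun v w h => ?_⟩
  · have : q r = Walk.nil := (hG.existsUnique_path r r).unique (hq r) Walk.IsPath.nil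
    simp [transport, this]
  · by_cases hv : v ∈ (q w).support
    · exact key v w h hv
    · have hw := hG.isAcyclic.mem_support_of_ne_mem_support_of_adj_of_isPath (hq v) (hq w) h hv
      change _ = t v w (transport (q v) m₀)
      rw [key w v h.symm hw, ht _ _ h.symm]

end SimpleGraph

namespace TriComplex

variable {V E F : Type*} (K : TriComplex V E F)

/-! ### Incidence numbers -/

theorem edge_injective (f : F) : Function.Injective (K.edge f) := by
  intro i j h
  have hi := K.edge_ends f i
  rw [h, K.edge_ends f j, Sym2.eq_iff] at hi
  have hv := K.vert_injective f
  rcases hi with ⟨h₁, _⟩ | ⟨h₁, h₂⟩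
  · exact (hv h₁).symm
  -- Sides traversed in opposite directions would force `i = i + 2` modulo 3.
  · have : ∀ i j : Fin 3, j = i + 1 → j + 1 = i → i = j := by decide
    exact this i j (hv h₁) (hv h₂)

theorem inc_edge (f : F) (i : Fin 3) : K.inc f (K.edge f i) = 1 ∨ K.inc f (K.edge f i) = -1 := by
  classical
  have : K.inc f (K.edge f i) = if K.src (K.edge f i) = K.vert f i then 1 else -1 := by
    simp [inc, (K.edge_injective f).eq_iff]
  rw [this]
  split_ifs <;> simp

theorem inc_sq {f : F} {e : E} (h : K.IsSide e f) : (K.inc f e : ℝ) ^ 2 = 1 := by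
  obtain ⟨i, rfl⟩ := h
  rcases K.inc_edge f i with h | h <;> simp [h]

theorem inc_ne_zero {f : F} {e : E} (h : K.IsSide e f) : (K.inc f e : ℝ) ≠ 0 := by
  intro h0
  simpa [h0] using K.inc_sq h

theorem inc_eq_zero {f : F} {e : E} (h : ¬ K.IsSide e f) : K.inc f e = 0 := by
  classical
  refine Finset.sum_eq_zero fun i _ => if_neg fun hi => h ⟨i, hi⟩

variable {K}

theorem IsSurface.eq_or_eq_of_isSide (hK : K.IsSurface) {e : E} {f f' g : F}
    (h : K.DualJoins e f f') (hg : K.IsSide e g) : g = f ∨ g = f' := by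
  have hsub : ({f, f'} : Set F) ⊆ {f | K.IsSide e f} := by
    rintro x (rfl | rfl)
    exacts [h.2.1, h.2.2]
  have hle : {f | K.IsSide e f}.ncard ≤ ({f, f'} : Set F).ncard := by
    rw [Set.ncard_pair h.1]
    rcases hK.edge_faces e with h | h <;> omega
  -- `ncard` is 0 on infinite sets, so a nonzero value gives finiteness.
  have hfin : {f | K.IsSide e f}.Finite := by
    refine Set.finite_of_ncard_ne_zero ?_
    rcases hK.edge_faces e with h | h <;> omega
  have := Set.eq_of_subset_of_ncard_le hsub hle hfin
  have hg' : g ∈ ({f, f'} : Set F) := by rw [this]; exact hg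
  simpa using hg'

theorem DualJoins.symm {e : E} {f f' : F} (h : K.DualJoins e f f') : K.DualJoins e f' f :=
  ⟨h.1.symm, h.2.2, h.2.1⟩

theorem DualJoins.notMem_boundaryEdges {e : E} {f f' : F} (h : K.DualJoins e f f') :
    e ∉ K.boundaryEdges := by
  intro he
  obtain ⟨a, ha⟩ := Set.ncard_eq_one.1 he
  have h₁ : f ∈ ({a} : Set F) := ha ▸ h.2.1
  have h₂ : f' ∈ ({a} : Set F) := ha ▸ h.2.2
  exact h.1 (h₁.trans h₂.symm)

theorem IsSurface.exists_dualJoins (hK : K.IsSurface) {e : E} (he : e ∉ K.boundaryEdges) :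
    ∃ f f', K.DualJoins e f f' := by
  have h2 : {f | K.IsSide e f}.ncard = 2 := (hK.edge_faces e).resolve_left he
  obtain ⟨f, f', hne, h⟩ := Set.ncard_eq_two.1 h2
  have hf : f ∈ {f | K.IsSide e f} := by rw [h]; simp
  have hf' : f' ∈ {f | K.IsSide e f} := by rw [h]; simp
  exact ⟨f, f', hne, hf, hf'⟩

/-! ### The coboundary of cochains on all edges -/

variable (K) in
/-- The coboundary map from 1-cochains to 2-cochains. -/
noncomputable def coboundary [Fintype E] : (E → ℝ) →ₗ[ℝ] (F → ℝ) :=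
  Matrix.mulVecLin (Matrix.of fun f e => (K.inc f e : ℝ))

theorem coboundary_apply [Fintype E] (c : E → ℝ) (f : F) :
    K.coboundary c f = ∑ e, (K.inc f e : ℝ) * c e := rfl

open scoped Classical in
theorem IsSurface.coboundary_single [Fintype E] (hK : K.IsSurface) {e : E} {f f' : F}
    (h : K.DualJoins e f f') (x : ℝ) : K.coboundary (Pi.single e x) =
      Pi.single f (K.inc f e * x) + Pi.single f' (K.inc f' e * x) := by
  funext g
  have h₀ : K.coboundary (Pi.single e x) g = K.inc g e * x := by
    simp [coboundary_apply, Pi.single_apply]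
  rw [h₀, Pi.add_apply]
  by_cases hg : K.IsSide e g
  · rcases hK.eq_or_eq_of_isSide h hg with rfl | rfl
    · simp [h.1]
    · simp [h.1.symm]
  · have h₁ : g ≠ f := fun H => hg (H ▸ h.2.1)
    have h₂ : g ≠ f' := fun H => hg (H ▸ h.2.2)
    simp [K.inc_eq_zero hg, h₁, h₂]

/-- Adjunction between the coboundary and its transpose. It is used with a test function isolating
one edge of `S` and with the signs `σ`, which kill all of `S`. -/
theorem sum_mul_coboundary [Fintype E] [Fintype F] (x : F → ℝ) (c : E → ℝ) :
    ∑ f, x f * K.coboundary c f = ∑ e, (∑ f, x f * K.inc f e) * c e := by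
  simp only [coboundary_apply, Finset.mul_sum, Finset.sum_mul]
  rw [Finset.sum_comm]
  simp only [mul_assoc]

theorem IsSurface.sum_mul_inc [Fintype F] (hK : K.IsSurface) {e : E} {f f' : F}
    (h : K.DualJoins e f f') (x : F → ℝ) :
    ∑ g, x g * K.inc g e = x f * K.inc f e + x f' * K.inc f' e := by
  classical
  rw [← Finset.sum_pair (f := fun g => x g * (K.inc g e : ℝ)) h.1]
  refine (Finset.sum_subset (Finset.subset_univ _) fun g _ hg => ?_).symm
  rw [K.inc_eq_zero, Int.cast_zero, mul_zero]
  intro hs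
  have := hK.eq_or_eq_of_isSide h hs
  simp at hg
  tauto

theorem barD1_restrict [Finite E] [Fintype E] {c : E → ℝ} (hc : ∀ e ∈ K.boundaryEdges, c e = 0) :
    K.barD1 (fun e => c e.1) = K.coboundary c := by
  funext f
  rw [coboundary_apply]
  change ∑ e : K.BarEdge, (K.inc f e.1 : ℝ) * c e.1 = _
  refine Finset.sum_of_injOn (fun e : K.BarEdge => e.1) ?_ ?_ ?_ ?_
  · intro a _ b _ hab; exact Subtype.ext hab
  · intro a _; simp
  · intro e _ he
    have : e ∈ K.boundaryEdges := by
      by_contra hne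
      exact he ⟨⟨e, hne⟩, by rw [Finset.coe_univ]; trivial, rfl⟩
    rw [hc e this, mul_zero]
  · intro a _; rfl

/-! ### The dual tree -/

namespace TreePair

variable (P : K.TreePair)

/-- The transpose of the coboundary map, restricted to the dual tree, is onto. -/
theorem exists_sum_mul_inc_eq [Fintype F] (hK : K.IsSurface) (y : E → ℝ) (r : F) (x₀ : ℝ) :
    ∃ x : F → ℝ, x r = x₀ ∧ ∀ e ∈ P.S, ∑ f, x f * K.inc f e = y e := by
  classical
  let s : F → F → E := fun f f' =>
    if h : (K.dualGraphOf P.S).Adj f f' then h.choose else K.edge f 0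
  have hs : ∀ f f', ∀ e ∈ P.S, K.DualJoins e f f' → s f f' = e := by
    intro f f' e he h
    have hadj : (K.dualGraphOf P.S).Adj f f' := ⟨e, he, h⟩
    simp only [s, dif_pos hadj]
    exact P.S_noParallel _ hadj.choose_spec.1 _ he f f' hadj.choose_spec.2 h
  obtain ⟨x, hx₀, hx⟩ := P.S_isTree.exists_potential
    -- The equation at the shared edge, solved for the value on `f'`.
    (fun f f' m => (y (s f f') - m * K.inc f (s f f')) / K.inc f' (s f f')) (by
      rintro f f' ⟨e, he, h⟩ m
      rw [hs f f' e he h, hs f' f e he h.symm]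
      have h₁ := K.inc_ne_zero h.2.1
      have h₂ := K.inc_ne_zero h.2.2
      field_simp
      ring) r x₀
  refine ⟨x, hx₀, fun e he => ?_⟩
  obtain ⟨f, f', h⟩ := hK.exists_dualJoins (P.S_subset e he).2
  have h₂ := K.inc_ne_zero h.2.2
  rw [hK.sum_mul_inc h, hx f f' ⟨e, he, h⟩, hs f f' e he h]
  field_simp
  ring

/-- A cocycle supported on the dual tree is zero. -/
theorem eq_zero_of_coboundary_eq_zero [Fintype E] [Fintype F] (hK : K.IsSurface) {c : E → ℝ}
    (hc : ∀ e ∉ P.S, c e = 0) (hD : K.coboundary c = 0) : c = 0 := by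
  classical
  funext e
  by_cases he : e ∈ P.S
  · have := P.S_isTree.connected.nonempty
    -- Pairing `c` with this `x` isolates `c e`.
    obtain ⟨x, -, hx⟩ := P.exists_sum_mul_inc_eq hK (Pi.single e 1) (Classical.arbitrary F) 0
    have h := K.sum_mul_coboundary x c
    rw [hD, Finset.sum_eq_single e, hx e he] at h
    · simpa using h.symm
    · intro e' _ hne
      by_cases he' : e' ∈ P.S
      · rw [hx e' he', Pi.single_eq_of_ne hne, zero_mul]
      · rw [hc e' he', mul_zero]
    · simp
  · exact hc e he

/-- The faces can be given signs that turn the dual tree into an oriented one. -/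
theorem exists_signs [Fintype F] (hK : K.IsSurface) : ∃ σ : F → ℝ, (∀ f, σ f ^ 2 = 1) ∧
    ∀ e ∈ P.S, ∑ f, σ f * K.inc f e = 0 := by
  have := P.S_isTree.connected.nonempty
  obtain ⟨σ, hσ₀, hσ⟩ := P.exists_sum_mul_inc_eq hK 0 (Classical.arbitrary F) 1
  refine ⟨σ, fun f => ?_, hσ⟩
  obtain ⟨w⟩ := P.S_isTree.connected f (Classical.arbitrary F)
  suffices H : ∀ {f f'}, (K.dualGraphOf P.S).Walk f f' → σ f ^ 2 = σ f' ^ 2 by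
    rw [H w, hσ₀, one_pow]
  intro f f' w
  induction w with
  | nil => rfl
  | @cons f f' _ h _ ih =>
    obtain ⟨e, he, h⟩ := h
    have h₀ := hσ e he
    rw [hK.sum_mul_inc h, Pi.zero_apply] at h₀
    -- Incidences are ±1, so the square of `σ` is constant along the tree.
    have h₁ : (σ f * K.inc f e) ^ 2 = (σ f' * K.inc f' e) ^ 2 := by
      rw [eq_neg_of_add_eq_zero_left h₀, neg_sq]
    rwa [mul_pow, mul_pow, K.inc_sq h.2.1, K.inc_sq h.2.2, mul_one, mul_one, ih] at h₁

end TreePair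

end TriComplex

namespace TriComplex

variable {V E F : Type*} {K : TriComplex V E F}

/-! ### The cochain of a path -/

namespace DualWalk

variable {S : Set E}

theorem mem_of_mem_edges {f f' : F} (p : K.DualWalk S f f') {e : E} (he : e ∈ p.edges) :
    e ∈ S := by
  induction p with
  | nil => simp [edges] at he
  | cons e' he' _ p ih =>
    rcases List.mem_cons.1 he with rfl | h
    exacts [he', ih h]

/-- Incidences being ±1, division by one is multiplication by it; hence the contributions of `a` and
`e` at `f` cancel. -/
theorem nextValue_mul_inc {f : F} {a e : E} (ha : K.IsSide a f) (he : K.IsSide e f) (c : E → ℝ) :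
    K.inc f e * nextValue K f a e c = -(K.inc f a * c a) := by
  have h₁ := K.inc_sq ha
  have h₂ := K.inc_sq he
  have h₃ := K.inc_ne_zero ha
  have h₄ : (K.inc f e : ℝ) * nextValue K f a e c =
      -((K.inc f e : ℝ) ^ 2 / K.inc f a * c a) := by
    rw [nextValue]; ring
  rw [h₄, h₂, ← h₁]
  field_simp

open scoped Classical in
/-- The effect of a sweep: the final cochain differs from the initial one only on the edges
crossed, and the coboundary is moved from the first face to the last one. -/
theorem sweep_spec [Fintype E] (hK : K.IsSurface) {f f' : F} (p : K.DualWalk S f f') (a : E)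
    (c : E → ℝ) (ha : K.IsSide a f) (hc : ∀ e ∈ p.edges, c e = 0) (hp : p.edges.Nodup) :
    K.IsSide (p.sweep a c).2 f' ∧ (∀ e ∉ p.edges, (p.sweep a c).1 e = c e) ∧
      K.coboundary (p.sweep a c).1 = K.coboundary c - Pi.single f (K.inc f a * c a) +
        Pi.single f' (K.inc f' (p.sweep a c).2 * (p.sweep a c).1 (p.sweep a c).2) := by
  induction p generalizing a c with
  | nil f => simpa [sweep] using ha
  | @cons f f₁ f' e he h p ih =>
    have hn := List.nodup_cons.1 hp
    set v := nextValue K f a e c with hv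
    have hce : c e = 0 := hc e List.mem_cons_self
    -- The edge `e` still carries 0, so overwriting is adding and linearity applies. This is where
    -- distinctness of the crossed edges matters.
    have hup : Function.update c e v = c + Pi.single e v := by
      funext x
      by_cases hx : x = e
      · subst hx; simp [hce]
      · simp [hx]
    obtain ⟨h₁, h₂, h₃⟩ := ih e (Function.update c e v) h.2.2 (fun x hx => by
      rw [Function.update_of_ne (fun H : x = e => hn.1 (H ▸ hx))]
      exact hc x (List.mem_cons_of_mem _ hx)) hn.2
    refine ⟨h₁, fun x hx => ?_, ?_⟩
    · rw [edges, List.mem_cons, not_or] at hx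
      exact (h₂ x hx.2).trans (Function.update_of_ne hx.1 _ _)
    · refine h₃.trans ?_
      rw [Function.update_self, hup, map_add, hK.coboundary_single h, hv,
        nextValue_mul_inc ha h.2.1, Pi.single_neg]
      simp only [sweep, hup, ← hv]
      abel

variable [Fintype E] {f f' f₂ f₂' : F} {e e' : E}

-- The indicator of `e` has coboundary at `f` and `f₂`; the sweep carries the part at `f` to `f'`
-- and leaves the part at `f₂` behind.
open scoped Classical in
theorem sweep_single_spec (hK : K.IsSurface) (p : K.DualWalk S f f') (h : K.DualJoins e f f₂)
    (heS : e ∉ S) (hp : p.edges.Nodup) :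
    K.IsSide (p.sweep e (Pi.single e 1)).2 f' ∧
      (∀ x ∉ S, (p.sweep e (Pi.single e 1)).1 x = (Pi.single e 1 : E → ℝ) x) ∧
      K.coboundary (p.sweep e (Pi.single e 1)).1 = Pi.single f₂ (K.inc f₂ e : ℝ) +
        Pi.single f' (K.inc f' (p.sweep e (Pi.single e 1)).2 *
          (p.sweep e (Pi.single e 1)).1 (p.sweep e (Pi.single e 1)).2) := by
  obtain ⟨h₁, h₂, h₃⟩ := p.sweep_spec hK e (Pi.single e 1) h.2.1 (fun x hx =>
    Pi.single_eq_of_ne (fun H : x = e => heS (H ▸ p.mem_of_mem_edges hx)) _) hp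
  refine ⟨h₁, fun x hx => h₂ x fun H => hx (p.mem_of_mem_edges H), h₃.trans ?_⟩
  rw [hK.coboundary_single h, Pi.single_eq_same, mul_one, mul_one]
  abel

/-- The cochain of a path between different edges. -/
theorem cochain_self (hK : K.IsSurface) (p : K.DualWalk S f f') (h : K.DualJoins e f f₂)
    (heS : e ∉ S) (hp : p.edges.Nodup) (hne : e' ≠ e) : p.cochain e e' e = 1 := by
  classical
  obtain ⟨-, h₂, -⟩ := p.sweep_single_spec hK h heS hp
  simp [cochain, hne, hne.symm, h₂ e heS]

theorem cochain_eq_zero_of_notMem (hK : K.IsSurface) (p : K.DualWalk S f f')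
    (h : K.DualJoins e f f₂) (heS : e ∉ S) (hp : p.edges.Nodup) {x : E} (hx : x ∉ S)
    (hxe : x ≠ e) (hxe' : x ≠ e') : p.cochain e e' x = 0 := by
  classical
  obtain ⟨-, h₂, -⟩ := p.sweep_single_spec hK h heS hp
  simp only [cochain]
  split_ifs
  · rfl
  · simp [hxe', h₂ x hx, hxe]

-- The value written on `e'` cancels what the sweep brought to `f'`, so only the faces beyond the
-- two end edges remain.
open scoped Classical in
theorem coboundary_cochain (hK : K.IsSurface) (p : K.DualWalk S f f') (h : K.DualJoins e f f₂)
    (heS : e ∉ S) (hp : p.edges.Nodup) (h' : K.DualJoins e' f' f₂') (heS' : e' ∉ S)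
    (hne : e' ≠ e) : K.coboundary (p.cochain e e') =
      Pi.single f₂ (K.inc f₂ e : ℝ) + Pi.single f₂' (K.inc f₂' e' * p.cochain e e' e') := by
  obtain ⟨h₁, h₂, h₃⟩ := p.sweep_single_spec hK h heS hp
  set r := p.sweep e (Pi.single e 1) with hr
  have hg : p.cochain e e' = r.1 + Pi.single e' (nextValue K f' r.2 e' r.1) := by
    funext x
    by_cases hx : x = e'
    · subst hx; simp [cochain, hne, h₂ x heS', ← hr]
    · simp [cochain, hne, hx, ← hr]
  have hz : p.cochain e e' e' = nextValue K f' r.2 e' r.1 := by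
    simp [cochain, hne, ← hr]
  rw [hz, hg, map_add, h₃, hK.coboundary_single h', nextValue_mul_inc h₁ h'.2.1, Pi.single_neg]
  abel

/-- The last value of the cochain of a path between different edges, in terms of signs of the
faces that orient the dual edges. -/
theorem sign_mul_cochain [Fintype F] (hK : K.IsSurface) (p : K.DualWalk S f f')
    (h : K.DualJoins e f f₂) (heS : e ∉ S) (hp : p.edges.Nodup) (h' : K.DualJoins e' f' f₂')
    (heS' : e' ∉ S) (hne : e' ≠ e) {σ : F → ℝ} (hσ : ∀ e ∈ S, ∑ f, σ f * K.inc f e = 0) :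
    σ f' * K.inc f' e' * p.cochain e e' e' = -(σ f * K.inc f e) := by
  classical
  have H := K.sum_mul_coboundary σ (p.cochain e e')
  rw [p.coboundary_cochain hK h heS hp h' heS' hne,
    ← Finset.sum_subset (Finset.subset_univ {e, e'}), Finset.sum_pair hne.symm,
    hK.sum_mul_inc h, hK.sum_mul_inc h', p.cochain_self hK h heS hp hne] at H
  · have hs : ∀ f (x : ℝ), ∑ g, σ g * (Pi.single f x : F → ℝ) g = σ f * x := by
      intro f x; simp [Pi.single_apply]
    simp only [Pi.add_apply, mul_add, Finset.sum_add_distrib, hs] at H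
    linarith
  · intro x _ hx
    simp only [Finset.mem_insert, Finset.mem_singleton, not_or] at hx
    by_cases hxS : x ∈ S
    · rw [hσ x hxS, zero_mul]
    · rw [p.cochain_eq_zero_of_notMem hK h heS hp hxS hx.1 hx.2, mul_zero]

/-- The cochain of a path from one face at an edge to the other one. -/
theorem cochain_closed [Fintype F] (hK : K.IsSurface) (p : K.DualWalk S f f')
    (h : K.DualJoins e f f') (heS : e ∉ S) (hp : p.edges.Nodup) {σ : F → ℝ}
    (hσ₁ : ∀ f, σ f ^ 2 = 1) (hσ : ∀ e ∈ S, ∑ f, σ f * K.inc f e = 0) :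
    p.cochain e e = 0 ∧ σ f * K.inc f e = σ f' * K.inc f' e ∨
      p.cochain e e e = 1 ∧ K.coboundary (p.cochain e e) = 0 := by
  classical
  obtain ⟨h₁, h₂, h₃⟩ := p.sweep_single_spec hK h heS hp
  set r := p.sweep e (Pi.single e 1) with hr
  have hv := nextValue_mul_inc h₁ h.2.2 r.1
  set z := nextValue K f' r.2 e r.1 with hz
  have hre : r.1 e = 1 := by rw [h₂ e heS, Pi.single_eq_same]
  -- The path ends at the face beyond `e`, so both remaining contributions sit at `f'`.
  have hcob : K.coboundary r.1 = Pi.single f' (K.inc f' e * (1 - z)) := by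
    rw [h₃, ← Pi.single_add]
    congr 1
    linarith
  by_cases hz1 : z = 1
  · right
    have hg : p.cochain e e = r.1 := by
      funext x
      by_cases hx : x = e
      · subst hx; simp [cochain, ← hr, ← hz, hz1, hre]
      · simp [cochain, ← hr, ← hz, hz1, hx]
    rw [hg, hcob, hz1]
    simp [hre]
  · left
    refine ⟨by simp [cochain, ← hr, ← hz, hz1], ?_⟩
    -- With `A`, `B` the signed incidences of `e` at `f`, `f'`, this pairing says `B * (1 - z) = A +
    -- B`. As `A = ±B`, the case `A = -B` would force `z = 1`.
    have H := K.sum_mul_coboundary σ r.1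
    rw [hcob, Finset.sum_eq_single e, hK.sum_mul_inc h, hre] at H
    · have hs : ∀ f (x : ℝ), ∑ g, σ g * (Pi.single f x : F → ℝ) g = σ f * x := by
        intro f x; simp [Pi.single_apply]
      rw [hs] at H
      have hA : (σ f * K.inc f e) ^ 2 = 1 := by rw [mul_pow, hσ₁, K.inc_sq h.2.1, one_mul]
      have hB : (σ f' * K.inc f' e) ^ 2 = 1 := by rw [mul_pow, hσ₁, K.inc_sq h.2.2, one_mul]
      have hBne : σ f' * K.inc f' e ≠ 0 := by
        intro h0; rw [h0] at hB; norm_num at hB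
      rcases sq_eq_sq_iff_eq_or_eq_neg.1 (hA.trans hB.symm) with h | h
      · exact h
      · refine absurd ?_ hz1
        have : σ f' * K.inc f' e * (1 - z) = 0 := by rw [h] at H; linarith
        rcases mul_eq_zero.1 this with h | h
        · exact absurd h hBne
        · linarith
    · intro x _ hx
      by_cases hxS : x ∈ S
      · rw [hσ x hxS, zero_mul]
      · rw [h₂ x hxS, Pi.single_eq_of_ne hx, mul_zero]
    · simp

end DualWalk

/-! ### Cohomology classes and cocycles vanishing on the tree -/

theorem barD0_apply [Finite V] (φ : K.BarNode → ℝ) (e : K.BarEdge) :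
    K.barD0 φ e = φ (K.toBarNode (K.tgt e.1)) - φ (K.toBarNode (K.src e.1)) := by
  classical
  simp [barD0, barIncEdge, sub_mul, Finset.sum_sub_distrib]

theorem toBarNode_src_eq {e : E} (he : e ∈ K.boundaryEdges) :
    K.toBarNode (K.src e) = K.toBarNode (K.tgt e) := by
  have : K.boundaryGraph.Adj (K.src e) (K.tgt e) := by
    rw [boundaryGraph, graphOf, SimpleGraph.fromEdgeSet_adj]
    exact ⟨⟨e, he, rfl⟩, K.src_ne_tgt e⟩
  exact SimpleGraph.ConnectedComponent.sound this.reachable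

theorem eq_of_reachable_graphOf {T : Set E} {M : Type*} {ψ : V → M}
    (h : ∀ e ∈ T, ψ (K.src e) = ψ (K.tgt e)) {v w : V} (hvw : (K.graphOf T).Reachable v w) :
    ψ v = ψ w := by
  obtain ⟨p⟩ := hvw
  induction p with
  | nil => rfl
  | @cons v w _ hadj _ ih =>
    rw [← ih]
    rw [graphOf, SimpleGraph.fromEdgeSet_adj] at hadj
    obtain ⟨⟨e, he, hvw⟩, -⟩ := hadj
    rcases Sym2.eq_iff.1 hvw with ⟨h₁, h₂⟩ | ⟨h₁, h₂⟩
    · rw [← h₁, ← h₂, h e he]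
    · rw [← h₁, ← h₂, h e he]

namespace TreePair

variable (P : K.TreePair)

/-- The potential is constant along `T`, whose boundary edges have identified ends, and `T` spans.
Hence a class has at most one representative vanishing on `T`. -/
theorem barD0_eq_zero [Finite V] (φ : K.BarNode → ℝ)
    (h : ∀ e : K.BarEdge, e.1 ∈ P.T → K.barD0 φ e = 0) : K.barD0 φ = 0 := by
  funext e
  rw [barD0_apply, Pi.zero_apply, sub_eq_zero]
  refine eq_of_reachable_graphOf (T := P.T) (ψ := fun v => φ (K.toBarNode v)) (fun e he => ?_)
    (P.T_isTree.connected _ _)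
  by_cases hb : e ∈ K.boundaryEdges
  · simp only [toBarNode_src_eq hb]
  · exact (sub_eq_zero.1 ((barD0_apply φ ⟨e, hb⟩).symm.trans (h ⟨e, hb⟩ he))).symm

/-- Integration along `T` with value 0 on boundary edges gives a potential that descends to the
collapsed nodes by `T_boundary`. Subtracting its coboundary makes any cochain vanish on `T`. -/
theorem exists_barD0_eq [Finite V] (c : K.BarEdge → ℝ) :
    ∃ φ : K.BarNode → ℝ, ∀ e : K.BarEdge, e.1 ∈ P.T → K.barD0 φ e = c e := by
  classical
  let c' : E → ℝ := fun e => if h : e ∉ K.boundaryEdges then c ⟨e, h⟩ else 0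
  let t : V → V → ℝ → ℝ := fun v w m =>
    if h : ∃ e ∈ P.T, s(K.src e, K.tgt e) = s(v, w) then
      if K.src h.choose = v then m + c' h.choose else m - c' h.choose
    else m
  have ht : ∀ v w, ∀ e ∈ P.T, s(K.src e, K.tgt e) = s(v, w) → ∀ m,
      t v w m = if K.src e = v then m + c' e else m - c' e := by
    intro v w e he h m
    have hex : ∃ e ∈ P.T, s(K.src e, K.tgt e) = s(v, w) := ⟨e, he, h⟩
    have : hex.choose = e :=
      P.T_noParallel hex.choose_spec.1 he (hex.choose_spec.2.trans h.symm)
    simp only [t, dif_pos hex, this]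
  have := P.T_isTree.connected.nonempty
  obtain ⟨ψ, -, hψ⟩ := P.T_isTree.exists_potential t (by
    intro v w hadj m
    rw [graphOf, SimpleGraph.fromEdgeSet_adj] at hadj
    obtain ⟨⟨e, he, hvw⟩, hne⟩ := hadj
    change s(K.src e, K.tgt e) = s(v, w) at hvw
    rw [ht v w e he hvw, ht w v e he (hvw.trans Sym2.eq_swap)]
    rcases Sym2.eq_iff.1 hvw with ⟨h₁, h₂⟩ | ⟨h₁, h₂⟩
    · simp [h₁, hne]
    · simp [h₁, hne.symm]) (Classical.arbitrary V) 0
  have hψT : ∀ e ∈ P.T, ψ (K.tgt e) = ψ (K.src e) + c' e := by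
    intro e he
    have hadj : (K.graphOf P.T).Adj (K.src e) (K.tgt e) := by
      rw [graphOf, SimpleGraph.fromEdgeSet_adj]
      exact ⟨⟨e, he, rfl⟩, K.src_ne_tgt e⟩
    rw [hψ _ _ hadj, ht _ _ e he rfl, if_pos rfl]
  have hconst : ∀ v w, K.boundaryGraph.Reachable v w → ψ v = ψ w := fun v w h => by
    refine eq_of_reachable_graphOf (fun e he => ?_) (P.T_boundary v w h)
    have h0 : c' e = 0 := dif_neg (not_not.2 he.2)
    rw [hψT e he.1, h0, add_zero]
  let φ : K.BarNode → ℝ :=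
    SimpleGraph.ConnectedComponent.lift ψ fun v w p _ => hconst v w p.reachable
  refine ⟨φ, fun e he => ?_⟩
  rw [barD0_apply]
  change ψ (K.tgt e.1) - ψ (K.src e.1) = c e
  have h0 : c' e.1 = c e := dif_pos e.2
  rw [hψT e.1 he, h0]
  ring

/-- Cocycles that vanish on the tree represent a basis of the cohomology as soon as they are dual
to some edges and every cocycle vanishing on the tree and these edges is zero. -/
theorem representsBasis_of_dual [Finite V] [Finite E] {ι : Type*} [Finite ι] (g : ι → E → ℝ)
    (j : ι → K.BarEdge) (hb : ∀ i, ∀ e ∈ K.boundaryEdges, g i e = 0)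
    (hz : ∀ i, (fun e : K.BarEdge => g i e.1) ∈ K.barZ1) (hT : ∀ i, ∀ e ∈ P.T, g i e = 0)
    (hj : ∀ i, g i (j i).1 = 1) (hj' : ∀ i i', i ≠ i' → g i (j i').1 = 0)
    (hspan : ∀ c ∈ K.barZ1, (∀ e : K.BarEdge, e.1 ∈ P.T → c e = 0) → (∀ i, c (j i) = 0) →
      c = 0) : K.RepresentsBasis g := by
  classical
  have := Fintype.ofFinite ι
  have hsum : ∀ (a : ι → ℝ) (i : ι), ∑ i', a i' * g i' (j i).1 = a i := by
    intro a i
    rw [Finset.sum_eq_single i, hj, mul_one]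
    · intro i' _ h; rw [hj' i' i h, mul_zero]
    · simp
  let z : ι → K.barZ1 := fun i => ⟨fun e => g i e.1, hz i⟩
  have hcoe : ∀ (a : ι → ℝ) (e : K.BarEdge),
      ((∑ i, a i • z i : K.barZ1) : K.BarEdge → ℝ) e = ∑ i, a i * g i e.1 := by
    intro a e
    simp [z, Finset.sum_apply]
  let Q := (K.barB1.submoduleOf K.barZ1).mkQ
  have hli : LinearIndependent ℝ fun i => Q (z i) := by
    rw [Fintype.linearIndependent_iff]
    intro a ha i
    have h0 : Q (∑ i, a i • z i) = 0 := by simpa using ha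
    rw [Submodule.mkQ_apply, Submodule.Quotient.mk_eq_zero] at h0
    obtain ⟨φ, hφ⟩ : ((∑ i, a i • z i : K.barZ1) : K.BarEdge → ℝ) ∈ K.barB1 := h0
    have hφ0 := P.barD0_eq_zero φ fun e he => by
      rw [hφ, hcoe]
      exact Finset.sum_eq_zero fun i _ => by rw [hT i _ he, mul_zero]
    rw [← hsum a i, ← hcoe, ← hφ, hφ0, Pi.zero_apply]
  have hsp : ⊤ ≤ Submodule.span ℝ (Set.range fun i => Q (z i)) := by
    rintro q -
    obtain ⟨c, rfl⟩ := Submodule.mkQ_surjective _ q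
    obtain ⟨φ, hφ⟩ := P.exists_barD0_eq c.1
    let b : K.barZ1 := ⟨K.barD0 φ, K.barD1_barD0 φ⟩
    -- By duality the coefficients are read off on the edges `j i`; the remainder vanishes there and
    -- on `T`.
    let a : ι → ℝ := fun i => c.1 (j i) - b.1 (j i)
    have hc : c - b - ∑ i, a i • z i = 0 := by
      refine Subtype.ext (hspan _ (c - b - ∑ i, a i • z i).2 (fun e he => ?_) fun i => ?_)
      · change c.1 e - b.1 e - ((∑ i, a i • z i : K.barZ1) : K.BarEdge → ℝ) e = 0
        rw [hcoe, Finset.sum_eq_zero fun i _ => by rw [hT i _ he, mul_zero]]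
        simp [b, hφ e he]
      · change c.1 (j i) - b.1 (j i) - ((∑ i, a i • z i : K.barZ1) : K.BarEdge → ℝ) (j i) = 0
        rw [hcoe, hsum, sub_self]
    have hb0 : Q b = 0 := by
      rw [Submodule.mkQ_apply, Submodule.Quotient.mk_eq_zero]
      exact ⟨φ, rfl⟩
    have hc' : c = b + ∑ i, a i • z i := by
      rw [sub_sub, sub_eq_zero] at hc; exact hc
    change Q c ∈ _
    rw [hc', map_add, hb0, zero_add, map_sum]
    refine Submodule.sum_mem _ fun i _ => ?_
    rw [map_smul]
    exact Submodule.smul_mem _ _ (Submodule.subset_span ⟨i, rfl⟩)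
  exact ⟨hb, hz, Module.Basis.mk hli hsp, fun i => Module.Basis.mk_apply hli hsp i⟩

end TreePair

end TriComplex

namespace TriComplex

variable {V E F : Type*} {K : TriComplex V E F}

/-! ### The handle cochains -/

namespace TreePair

variable {P : K.TreePair}

theorem notMem_S_of_mem_EM {e : E} (he : e ∈ P.EM) : e ∉ P.S := fun h => he.2 (Or.inl h)

theorem notMem_boundaryEdges_of_mem_EM {e : E} (he : e ∈ P.EM) : e ∉ K.boundaryEdges :=
  fun h => he.2 (Or.inr ⟨h, he.1⟩)

theorem mem_EM {e : E} (hT : e ∉ P.T) (hb : e ∉ K.boundaryEdges) (hS : e ∉ P.S) : e ∈ P.EM :=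
  ⟨hT, fun h => h.elim hS fun h => hb h.1⟩

/-- An edge of `EM` as a 1-cell of the closed complex. -/
def EM.toBarEdge (e : P.EM) : K.BarEdge := ⟨e.1, notMem_boundaryEdges_of_mem_EM e.2⟩

/-- A non-boundary edge outside `T` and `S` lies in `EM`, so extension by zero leaves only `S` and
`EM` as support. -/
theorem exists_extension [Finite E] [Fintype E] {c : K.BarEdge → ℝ} (hc : c ∈ K.barZ1)
    (hT : ∀ e : K.BarEdge, e.1 ∈ P.T → c e = 0) : ∃ c' : E → ℝ, (∀ e : K.BarEdge, c' e.1 = c e) ∧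
      (∀ e ∉ P.S, e ∉ P.EM → c' e = 0) ∧ K.coboundary c' = 0 := by
  classical
  let c' : E → ℝ := fun e => if h : e ∉ K.boundaryEdges then c ⟨e, h⟩ else 0
  have h₁ : ∀ e : K.BarEdge, c' e.1 = c e := fun e => dif_pos e.2
  have h₂ : ∀ e ∈ K.boundaryEdges, c' e = 0 := fun e he => dif_neg (not_not.2 he)
  refine ⟨c', h₁, fun e hS hM => ?_, ?_⟩
  · by_cases hb : e ∈ K.boundaryEdges
    · exact h₂ e hb
    · have he : e ∈ P.T := by
        by_contra h
        exact hM (mem_EM h hb hS)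
      exact (h₁ ⟨e, hb⟩).trans (hT ⟨e, hb⟩ he)
  · rw [← barD1_restrict h₂, funext h₁]
    exact hc

/-- A criterion for a family indexed by edges of `EM` to represent a basis, stated for cochains
of the triangulation. -/
theorem representsBasis_of_EM [Finite V] [Finite E] [Fintype E] {ι : Type*} [Finite ι]
    (g : ι → E → ℝ) (j : ι → P.EM) (h0 : ∀ i, ∀ e ∉ P.S, e ∉ P.EM → g i e = 0)
    (hz : ∀ i, K.coboundary (g i) = 0) (hj : ∀ i, g i (j i) = 1)
    (hj' : ∀ i i', i ≠ i' → g i (j i') = 0)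
    (hspan : ∀ c : E → ℝ, (∀ e ∉ P.S, e ∉ P.EM → c e = 0) → K.coboundary c = 0 →
      (∀ i, c (j i) = 0) → c = 0) : K.RepresentsBasis g := by
  have hb : ∀ i, ∀ e ∈ K.boundaryEdges, g i e = 0 := fun i e he =>
    h0 i e (fun h => (P.S_subset e h).2 he) fun h => notMem_boundaryEdges_of_mem_EM h he
  refine P.representsBasis_of_dual g (fun i => EM.toBarEdge (j i)) hb (fun i => ?_)
    (fun i e he => h0 i e (fun h => (P.S_subset e h).1 he) fun h => h.1 he) hj hj' ?_
  · exact (barD1_restrict (hb i)).trans (hz i)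
  · intro c hc hT hcj
    obtain ⟨c', h₁, h₂, h₃⟩ := exists_extension hc hT
    have := hspan c' h₂ h₃ fun i => (h₁ (EM.toBarEdge (j i))).trans (hcj i)
    funext e
    rw [← h₁, this]
    rfl

namespace FirstLoop

variable [Fintype E] (hK : K.IsSurface) (A : P.FirstLoop)

include hK

theorem cochain_eq_zero (e : P.EM) {x : E} (hx : x ∉ P.S) (hxe : x ≠ e) :
    A.cochain e x = 0 :=
  (A.path e).cochain_eq_zero_of_notMem hK (A.joins e) (notMem_S_of_mem_EM e.2) (A.isPath e).2
    hx hxe hxe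

variable [Fintype F] {σ : F → ℝ} (hσ₁ : ∀ f, σ f ^ 2 = 1) (hσ : ∀ e ∈ P.S, ∑ f, σ f * K.inc f e = 0)

include hσ₁ hσ

theorem cochain_spec {e : P.EM} (he : e ∉ A.EMII) :
    A.cochain e e = 1 ∧ K.coboundary (A.cochain e) = 0 :=
  ((A.path e).cochain_closed hK (A.joins e) (notMem_S_of_mem_EM e.2) (A.isPath e).2
    hσ₁ hσ).resolve_left fun h => he h.1

/-- The zero cochain excludes the cocycle alternative, which has value 1 on `e`. -/
theorem sign_eq {e : P.EM} (he : e ∈ A.EMII) :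
    σ (A.face₁ e) * K.inc (A.face₁ e) e = σ (A.face₂ e) * K.inc (A.face₂ e) e := by
  refine (((A.path e).cochain_closed hK (A.joins e) (notMem_S_of_mem_EM e.2) (A.isPath e).2
    hσ₁ hσ).resolve_right fun h => ?_).2
  have h1 : A.cochain e e = 1 := h.1
  rw [show A.cochain e = 0 from he] at h1
  exact zero_ne_one h1

/-- Needed because the second loop labels the faces at `e₀` afresh. -/
theorem sign_eq_of_dualJoins {e : P.EM} (he : e ∈ A.EMII) {f f' : F} (h : K.DualJoins e f f') :
    σ f * K.inc f e = σ f' * K.inc f' e := by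
  have h₀ := A.sign_eq hK hσ₁ hσ he
  rcases hK.eq_or_eq_of_isSide (A.joins e) h.2.1 with rfl | rfl <;>
    rcases hK.eq_or_eq_of_isSide (A.joins e) h.2.2 with rfl | rfl
  · rfl
  · exact h₀
  · exact h₀.symm
  · rfl

/-- The cochain computed by the second loop for a torsion edge. -/
theorem SecondLoop.cochain_spec {A : P.FirstLoop} {e₀ : P.EM} (he₀ : e₀ ∈ A.EMII)
    (B : A.SecondLoop e₀) {e : P.EM} (hne : e ≠ e₀) (he : e ∈ A.EMII) :
    B.cochain e e = 1 ∧ (∀ x ∉ P.S, x ≠ e → x ≠ e₀ → B.cochain e x = 0) ∧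
      K.coboundary (B.cochain e) = 0 := by
  classical
  have hne' : e₀.1 ≠ e.1 := fun h => hne (Subtype.ext h.symm)
  have hS := notMem_S_of_mem_EM e.2
  have hS₀ := notMem_S_of_mem_EM e₀.2
  have hj := A.joins e
  have hj₀ := B.joins e
  have hp₁ := (B.isPath₁ e).2
  have hp₂ := (B.isPath₂ e).2
  set g₁ := (B.path₁ e).cochain e.1 e₀.1 with hg₁
  set g₂ := (B.path₂ e).cochain e.1 e₀.1 with hg₂
  have hz₁ := (B.path₁ e).sign_mul_cochain hK hj hS hp₁ hj₀ hS₀ hne' hσ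
  have hz₂ := (B.path₂ e).sign_mul_cochain hK hj.symm hS hp₂ hj₀.symm hS₀ hne' hσ
  rw [← hg₁] at hz₁
  rw [← hg₂] at hz₂
  have hc₁ := (B.path₁ e).coboundary_cochain hK hj hS hp₁ hj₀ hS₀ hne'
  have hc₂ := (B.path₂ e).coboundary_cochain hK hj.symm hS hp₂ hj₀.symm hS₀ hne'
  have h1₁ : g₁ e = 1 := (B.path₁ e).cochain_self hK hj hS hp₁ hne'
  have h1₂ : g₂ e = 1 := (B.path₂ e).cochain_self hK hj.symm hS hp₂ hne'
  -- The `σ`-pairing gives each end value as a quotient of signed incidences; both `e` and `e₀`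
  -- being torsion, the two quotients agree.
  have hz : g₂ e₀ = g₁ e₀ := by
    have hs₀ := A.sign_eq_of_dualJoins hK hσ₁ hσ he₀ hj₀
    rw [A.sign_eq hK hσ₁ hσ he, hs₀, ← hz₂] at hz₁
    refine (mul_left_cancel₀ ?_ hz₁).symm
    refine mul_ne_zero (fun h => ?_) (K.inc_ne_zero hj₀.2.2)
    simpa [h] using hσ₁ (B.star₂ e)
  have hG : B.cochain e = fun a => if a = e.1 ∨ a = e₀.1 then g₁ a else g₁ a + g₂ a := if_pos he
  -- The sum counts `e` and `e₀` twice. The coboundaries of `g₁` and `g₂` together make up that of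
  -- the subtracted terms, so the difference is a cocycle.
  have hG' : B.cochain e = g₁ + g₂ - Pi.single e.1 1 - Pi.single e₀.1 (g₁ e₀) := by
    rw [hG]
    funext a
    by_cases ha : a = e
    · subst ha; simp [h1₁, h1₂, hne'.symm]
    · by_cases ha₀ : a = e₀
      · subst ha₀; simp [hz, hne']
      · simp [ha, ha₀]
  refine ⟨by rw [hG]; simp [h1₁], fun x hx hxe hxe₀ => ?_, ?_⟩
  · rw [hG]
    simp only [hxe, hxe₀, or_self, if_false]
    rw [hg₁, hg₂, (B.path₁ e).cochain_eq_zero_of_notMem hK hj hS hp₁ hx hxe hxe₀,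
      (B.path₂ e).cochain_eq_zero_of_notMem hK hj.symm hS hp₂ hx hxe hxe₀, add_zero]
  · rw [hG', map_sub, map_sub, map_add, hc₁, hc₂, hK.coboundary_single hj,
      hK.coboundary_single hj₀, ← hg₁, ← hg₂, hz, mul_one, mul_one]
    abel

end FirstLoop

end TreePair

end TriComplex

/-! ### The two cases of the theorem. -/

theorem mainTheorem3 {V E F : Type*} [Finite V] [Finite E] [Finite F]
    (K : TriComplex V E F) (hK : K.IsSurface) (P : K.TreePair) (A : P.FirstLoop) :
    (A.EMII = ∅ → K.RepresentsBasis A.cochain) ∧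
    (∀ e₀ ∈ A.EMII, ∀ B : A.SecondLoop e₀,
      K.RepresentsBasis (fun e : {e : P.EM // e ≠ e₀} => B.cochain e.1)) := by
  classical
  have := Fintype.ofFinite E
  have := Fintype.ofFinite F
  obtain ⟨σ, hσ₁, hσ⟩ := P.exists_signs hK
  have hne : ∀ {x : E} {e : P.EM}, x ∉ P.EM → x ≠ e := fun {x e} hx h => hx (h ▸ e.2)
  constructor
  · intro hA
    have hA' : ∀ e, e ∉ A.EMII := fun e => hA ▸ Set.notMem_empty e
    refine P.representsBasis_of_EM A.cochain id
      (fun e x hx hxM => A.cochain_eq_zero hK e hx (hne hxM))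
      (fun e => (A.cochain_spec hK hσ₁ hσ (hA' e)).2)
      (fun e => (A.cochain_spec hK hσ₁ hσ (hA' e)).1)
      (fun e e' h => A.cochain_eq_zero hK e (P.notMem_S_of_mem_EM e'.2)
        fun H => h (Subtype.ext H.symm)) fun c h0 hD hc => ?_
    refine P.eq_zero_of_coboundary_eq_zero hK (fun x hx => ?_) hD
    by_cases hxM : x ∈ P.EM
    · exact hc ⟨x, hxM⟩
    · exact h0 x hx hxM
  · intro e₀ he₀ B
    have key : ∀ e : P.EM, e ≠ e₀ → B.cochain e e = 1 ∧
        (∀ x ∉ P.S, x ≠ e → x ≠ e₀ → B.cochain e x = 0) ∧ K.coboundary (B.cochain e) = 0 := by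
      intro e h
      by_cases he : e ∈ A.EMII
      · exact B.cochain_spec hK hσ₁ hσ he₀ h he
      · have hB : B.cochain e = A.cochain e := if_neg he
        have hs := A.cochain_spec hK hσ₁ hσ he
        rw [hB]
        exact ⟨hs.1, fun x hx hxe _ => A.cochain_eq_zero hK e hx hxe, hs.2⟩
    refine P.representsBasis_of_EM _ (fun e => e.1)
      (fun e x hx hxM => (key e.1 e.2).2.1 x hx (hne hxM) (hne hxM))
      (fun e => (key e.1 e.2).2.2) (fun e => (key e.1 e.2).1)
      (fun e e' h => (key e.1 e.2).2.1 _ (P.notMem_S_of_mem_EM e'.1.2)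
        (fun H => h (Subtype.ext (Subtype.ext H.symm))) fun H => e'.2 (Subtype.ext H))
      fun c h0 hD hc => ?_
    have hc' : ∀ x ∉ P.S, x ≠ e₀ → c x = 0 := by
      intro x hx hx₀
      by_cases hxM : x ∈ P.EM
      · exact hc ⟨⟨x, hxM⟩, fun H => hx₀ (congrArg Subtype.val H)⟩
      · exact h0 x hx hxM
    refine P.eq_zero_of_coboundary_eq_zero hK (fun x hx => ?_) hD
    by_cases hx₀ : x = e₀
    · subst hx₀
      have hj := A.joins e₀
      -- Only `e₀` survives in the pairing, with coefficient twice a nonzero number, so `c` vanishes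
      -- there too.
      have H := K.sum_mul_coboundary σ c
      rw [hD, Finset.sum_eq_single e₀.1, hK.sum_mul_inc hj, A.sign_eq hK hσ₁ hσ he₀] at H
      · have hs : σ (A.face₂ e₀) ≠ 0 := fun h => by simpa [h] using hσ₁ (A.face₂ e₀)
        have hi := K.inc_ne_zero hj.2.2
        simpa [← two_mul, hs, hi] using H
      · intro y _ hy
        by_cases hyS : y ∈ P.S
        · rw [hσ y hyS, zero_mul]
        · rw [hc' y hyS hy, mul_zero]
      · simp
    · exact hc' x hx hx₀
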